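/- **Setting.** Formulas are given by $\alpha ::= p \mid \bot \mid \alpha\to\alpha \mid \Box\alpha$, with $p$ ranging over a set $\mathsf{At}$ of propositional variables, $\neg\alpha := \alpha\to\bot$ and $\Diamond\alpha := \neg\Box\neg\alpha$. Let $L$ be one of the fifteen logics of the modal cube, $K, KB, K4, K5, K45, KD, KDB, KD4, KD5, KD45, KT, KTB, KT4, KTB45, KB45$, obtained from $K$ by adding the named schemata among $$D:\ \Box\alpha\to\Diamond\alpha,\quad T:\ \Box\alpha\to\alpha,\quad B:\ \alpha\to\Box\Diamond\alpha,\quad 4:\ \Box\alpha\to\Box\Box\alpha,\quad 5:\ \Diamond\alpha\to\Box\Diamond\alpha .$$ $\Gamma\vdash^L\alpha$ means that $\alpha$ is derivable from the possibly infinite set $\Gamma$ in the Hilbert system with the axioms of classical propositional logic, $\Box(\alpha\to\beta)\to(\Box\alpha\to\Box\beta)$, the schemata of $L$, modus ponens, and necessitation (applied to theorems only). **Truth values.** There are eight values $F,f,f_1,f_2,t_2,t_1,t,T$, with $$\mathcal D=\{T,t,t_1,t_2\},\quad N=\{T,t_1,f_2,f_1\},\quad I=\{F,f_1,t_2,t_1\},\quad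 P=\{T,t,f_2,f\},\quad PN=\{F,f,t_2,t\}.$$ The set $\mathcal V(L)$ consists of all eight values for $K,KB,K4,K5,K45$; of all but $f_1,t_1$ for the five logics whose name begins with $KD$; of $F,f,t,T$ for the four logics whose name begins with $KT$; and of all but $f_2,t_2$ for $KB45$. **Nmatrix of $L$.** The values are $\mathcal V(L)$, the designated values are $\mathcal D\cap\mathcal V(L)$, and all tables below are restricted to $\mathcal V(L)$. $\tilde\bot=\{F,f_1\}$. The implication table (rows: antecedent, columns: consequent, set braces omitted) is $$\begin{array}{c|cccccccc} \tilde\to&F&f&f_1&f_2&t_2&t_1&t&T\\\hline F&T&T&T&T&T&T&T&T\\ f&t&T,t&t_1&T&t&T&T,t&T\\ f_1&t_2&t&t_1&T&t_2&t_1&t&T\\ f_2&t_2&t&t_1&T&t_2&t_1&t&T\\ t_2&f_2&f_2&f_2&f_2&T&T&T&T\\ t_1&F&f&f_1&f_2&t_2&t_1&t_2&T\\ t&f&f,f_2&f_2&f_2&t&T&T,t&T\\ T&F&f&f_1&f_2&t_2&t_1&t&T \end{array}$$ The table for $\Box$ (columns: the value of $\alpha$; a dash marks a value that is not in $\mathcal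 V(L)$) is $$\begin{array}{c|cccccccc} \tilde\Box&F&f&f_1&f_2&t_2&t_1&t&T\\\hline K&F,f,f_2&F,f,f_2&t_1&T,t,t_2&F,f,f_2&t_1&F,f,f_2&T,t,t_2\\ KB&F&F&t_1&t_2&F,f,f_2&t_1&F,f,f_2&T,t,t_2\\ K4&F,f,f_2&F,f,f_2&t_1&T&F,f,f_2&t_1&F,f,f_2&T\\ K5&F&F&t_1&T,t_2&F&t_1&F&T,t_2\\ K45&F&F&t_1&T&F&t_1&F&T\\ KB45&F&F&t_1&-&-&t_1&F&T\\ KD&F,f,f_2&F,f,f_2&-&T,t,t_2&F,f,f_2&-&F,f,f_2&T,t,t_2\\ KDB&F&F&-&t_2&F,f,f_2&-&F,f,f_2&T,t,t_2\\ KD4&F&F,f,f_2&-&T&F&-&F,f,f_2&T\\ KD5&F&F&-&T,t_2&F&-&F&T,t_2\\ KD45&F&F&-&T&F&-&F&T\\ KT&F&F,f&-&-&-&-&F,f&T,t\\ KTB&F&F&-&-&-&-&F,f&T,t\\ KT4&F&F,f&-&-&-&-&F,f&T\\ KTB45&F&F&-&-&-&-&F&T \end{array}$$ **Partial valuations.**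 Let $\Lambda$ be a set of formulas closed under subformulas. A *partial valuation* on $\Lambda$ is a map $v:\Lambda\to\mathcal V(L)$ with $v(\bot)\in\tilde\bot$, $v(\alpha\to\beta)\in v(\alpha)\mathbin{\tilde\to}v(\beta)$ and $v(\Box\alpha)\in\tilde\Box(v(\alpha))$ whenever the formula on the left belongs to $\Lambda$. **Models.** An *$L$-model* on $\Lambda$ is a pair $\langle\Pi,R\rangle$ with $\Pi$ a set of partial valuations on $\Lambda$ and $R\subseteq\Pi\times\Pi$ such that, for all $\alpha\in\Lambda$ and all $v,w,u\in\Pi$: * if $v(\alpha)\in P$, some $v'\in\Pi$ has $vRv'$ and $v'(\alpha)\in\mathcal D$; if $v(\alpha)\in PN$, some $v'\in\Pi$ has $vRv'$ and $v'(\alpha)\notin\mathcal D$; * if $vRw$: $v(\alpha)\in N$ implies $w(\alpha)\in\mathcal D$, and $v(\alpha)\in I$ implies $w(\alpha)\notin\mathcal D$; and, for each of the schemata $T,D,B,4,5$ all of whose instances are theorems of $L$, the corresponding condition holds: * $T$: $v(\alpha)\in N$ implies $v(\alpha)\in\mathcal D$, and $v(\alpha)\in I$ implies $v(\alpha)\notin\mathcal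 D$; * $D$: $v(\alpha)\in N$ implies $v(\alpha)\in P$, and $v(\alpha)\in I$ implies $v(\alpha)\in PN$; * $B$: if $vRw$, then $v(\alpha)\in\mathcal D$ implies $w(\alpha)\in P$, and $v(\alpha)\notin\mathcal D$ implies $w(\alpha)\in PN$; * $4$: if $vRw$, then $v(\alpha)\in N$ implies $w(\alpha)\in N$, and $v(\alpha)\in I$ implies $w(\alpha)\in I$; * $5$: if $vRw$, then $v(\alpha)\in P$ implies $w(\alpha)\in P$, and $v(\alpha)\in PN$ implies $w(\alpha)\in PN$; moreover, if $vRw$ and ($vRu$ or $wRu$), then $v(\alpha),w(\alpha)\in N$ implies $u(\alpha)\in N$, and $v(\alpha),w(\alpha)\in I$ implies $u(\alpha)\in I$. A *partial level-valuation* of $L$ on $\Lambda$ is a partial valuation that belongs to $\Pi$ for some $L$-model $\langle\Pi,R\rangle$ on $\Lambda$. Write $\Gamma\vDash^L\alpha$ if every partial level-valuation $v$ of $L$ on the smallest subformula-closed set containing $\Gamma\cup\{\alpha\}$ satisfies: if $v(\beta)\in\mathcal D$ for all $\beta\in\Gamma$, then $v(\alpha)\in\mathcal D$. **Theorem (Soundness).**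 For every logic $L$ of the modal cube, every set $\Gamma$ of formulas and every formula $\alpha$: if $\Gamma\vdash^L\alpha$, then $\Gamma\vDash^L\alpha$. -/

import Mathlib

namespace ModalCube

/-! ### Syntax -/

/-- Modal formulas over a set `At` of propositional variables. -/
inductive Fm (At : Type*) where
  | var : At → Fm At
  | bot : Fm At
  | imp : Fm At → Fm At → Fm At
  | box : Fm At → Fm At

namespace Fm

variable {At : Type*}

/-- `¬ α` abbreviates `α → ⊥`. -/
def neg (a : Fm At) : Fm At := imp a bot

/-- `◇ α` abbreviates `¬ □ ¬ α`. -/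
def dia (a : Fm At) : Fm At := neg (box (neg a))

end Fm

/-- Closure of a set of formulas under (immediate, hence all) subformulas. -/
def SubformulaClosed {At : Type*} (Λ : Set (Fm At)) : Prop :=
  (∀ a b, Fm.imp a b ∈ Λ → a ∈ Λ ∧ b ∈ Λ) ∧ (∀ a, Fm.box a ∈ Λ → a ∈ Λ)

/-- The smallest set that contains `Γ` and is closed under subformulas. -/
def subformulaClosure {At : Type*} (Γ : Set (Fm At)) : Set (Fm At) :=
  ⋂₀ {Λ | Γ ⊆ Λ ∧ SubformulaClosed Λ}

theorem subset_subformulaClosure {At : Type*} (Γ : Set (Fm At)) :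
    Γ ⊆ subformulaClosure Γ :=
  fun _ ha _ hΛ => hΛ.1 ha

theorem subformulaClosed_subformulaClosure {At : Type*} (Γ : Set (Fm At)) :
    SubformulaClosed (subformulaClosure Γ) :=
  ⟨fun a b h => ⟨fun Λ hΛ => (hΛ.2.1 a b (h Λ hΛ)).1, fun Λ hΛ => (hΛ.2.1 a b (h Λ hΛ)).2⟩,
    fun a h Λ hΛ => hΛ.2.2 a (h Λ hΛ)⟩

/-! ### The fifteen logics and their Hilbert systems -/

/-- The five modal schemata that are added to `K`. -/
inductive Schema where
  | D | T | B | four | five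

/-- The instance of a modal schema at a formula. -/
def Schema.inst {At : Type*} (a : Fm At) : Schema → Fm At
  | .D => .imp (.box a) (.dia a)
  | .T => .imp (.box a) a
  | .B => .imp a (.box (.dia a))
  | .four => .imp (.box a) (.box (.box a))
  | .five => .imp (.dia a) (.box (.dia a))

/-- The fifteen logics of the modal cube. `KT4` is `S4`, `KTB45` is `S5`, `KB45` is `KB5`. -/
inductive Logic where
  | K | KB | K4 | K5 | K45
  | KD | KDB | KD4 | KD5 | KD45
  | KT | KTB | KT4 | KTB45
  | KB45

/-- The schemata that are added to `K` to obtain the logic. -/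
def Logic.schemata : Logic → Set Schema
  | .K => ∅
  | .KB => {.B}
  | .K4 => {.four}
  | .K5 => {.five}
  | .K45 => {.four, .five}
  | .KD => {.D}
  | .KDB => {.D, .B}
  | .KD4 => {.D, .four}
  | .KD5 => {.D, .five}
  | .KD45 => {.D, .four, .five}
  | .KT => {.T}
  | .KTB => {.T, .B}
  | .KT4 => {.T, .four}
  | .KTB45 => {.T, .B, .four, .five}
  | .KB45 => {.B, .four, .five}

/-- `Derives L Γ α` is `Γ ⊢ α` in the Hilbert system of `L`. This is the usual (local)
consequence relation: necessitation applies to theorems only. -/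
inductive Derives {At : Type*} (L : Logic) : Set (Fm At) → Fm At → Prop
  | hyp {Γ : Set (Fm At)} {a : Fm At} : a ∈ Γ → Derives L Γ a
  | ax1 {Γ : Set (Fm At)} (a b : Fm At) : Derives L Γ (.imp a (.imp b a))
  | ax2 {Γ : Set (Fm At)} (a b c : Fm At) :
      Derives L Γ (.imp (.imp a (.imp b c)) (.imp (.imp a b) (.imp a c)))
  | ax3 {Γ : Set (Fm At)} (a : Fm At) : Derives L Γ (.imp (.neg (.neg a)) a)
  | axK {Γ : Set (Fm At)} (a b : Fm At) :
      Derives L Γ (.imp (.box (.imp a b)) (.imp (.box a) (.box b)))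
  | modal {Γ : Set (Fm At)} (s : Schema) (a : Fm At) : s ∈ L.schemata → Derives L Γ (s.inst a)
  | mp {Γ : Set (Fm At)} {a b : Fm At} :
      Derives L Γ (.imp a b) → Derives L Γ a → Derives L Γ b
  | nec {Γ : Set (Fm At)} {a : Fm At} : Derives L ∅ a → Derives L Γ (.box a)

/-- A modal schema holds in `L` (over the variables `At`) if all its instances are theorems. -/
def Logic.Holds (At : Type*) (L : Logic) (s : Schema) : Prop :=
  ∀ a : Fm At, Derives L ∅ (s.inst a)

/-! ### Truth values and Nmatrices -/

/-- The eight truth values. -/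
inductive Value where
  | vF | vf | vff | vfff | vttt | vtt | vt | vT
  deriving DecidableEq

open Value

/-- The values for "`α` is true". -/
def desig : Finset Value := {vT, vt, vtt, vttt}

/-- The values for "`α` is necessary". -/
def valN : Finset Value := {vT, vtt, vfff, vff}

/-- The values for "`¬ α` is necessary". -/
def valI : Finset Value := {vF, vff, vttt, vtt}

/-- The values for "`α` is possible". -/
def valP : Finset Value := {vT, vt, vfff, vf}

/-- The values for "`¬ α` is possible". -/
def valPN : Finset Value := {vF, vf, vttt, vt}

/-- The truth values of a logic. -/
def Logic.values : Logic → Finset Value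
  | .K | .KB | .K4 | .K5 | .K45 => {vF, vf, vff, vfff, vttt, vtt, vt, vT}
  | .KB45 => {vF, vf, vff, vtt, vt, vT}
  | .KD | .KDB | .KD4 | .KD5 | .KD45 => {vF, vf, vfff, vttt, vt, vT}
  | .KT | .KTB | .KT4 | .KTB45 => {vF, vf, vt, vT}

/-- The multifunction for `⊥`. -/
def botTable : Finset Value := {vF, vff}

/-- The multifunction for `→`; the first argument is the value of the antecedent. -/
def impTable : Value → Value → Finset Value
  | vF, _ => {vT}
  | vf, b => match b with
    | vF => {vt} | vf => {vT, vt} | vff => {vtt} | vfff => {vT}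
    | vttt => {vt} | vtt => {vT} | vt => {vT, vt} | vT => {vT}
  | vff, b => match b with
    | vF => {vttt} | vf => {vt} | vff => {vtt} | vfff => {vT}
    | vttt => {vttt} | vtt => {vtt} | vt => {vt} | vT => {vT}
  | vfff, b => match b with
    | vF => {vttt} | vf => {vt} | vff => {vtt} | vfff => {vT}
    | vttt => {vttt} | vtt => {vtt} | vt => {vt} | vT => {vT}
  | vttt, b => match b with
    | vF => {vfff} | vf => {vfff} | vff => {vfff} | vfff => {vfff}
    | vttt => {vT} | vtt => {vT} | vt => {vT} | vT => {vT}
  | vtt, b => match b with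
    | vF => {vF} | vf => {vf} | vff => {vff} | vfff => {vfff}
    | vttt => {vttt} | vtt => {vtt} | vt => {vttt} | vT => {vT}
  | vt, b => match b with
    | vF => {vf} | vf => {vf, vfff} | vff => {vfff} | vfff => {vfff}
    | vttt => {vt} | vtt => {vT} | vt => {vT, vt} | vT => {vT}
  | vT, b => match b with
    | vF => {vF} | vf => {vf} | vff => {vff} | vfff => {vfff}
    | vttt => {vttt} | vtt => {vtt} | vt => {vt} | vT => {vT}

/-- The multifunction for `□` in each logic (empty at values that the logic does not use). -/
def boxTable : Logic → Value → Finset Value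
  | .K, a => match a with
    | vF | vf | vttt | vt => {vF, vf, vfff}
    | vff | vtt => {vtt}
    | vfff | vT => {vT, vt, vttt}
  | .KB, a => match a with
    | vF | vf => {vF}
    | vttt | vt => {vF, vf, vfff}
    | vff | vtt => {vtt}
    | vfff => {vttt}
    | vT => {vT, vt, vttt}
  | .K4, a => match a with
    | vF | vf | vttt | vt => {vF, vf, vfff}
    | vff | vtt => {vtt}
    | vfff | vT => {vT}
  | .K5, a => match a with
    | vF | vf | vttt | vt => {vF}
    | vff | vtt => {vtt}
    | vfff | vT => {vT, vttt}
  | .K45, a => match a with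
    | vF | vf | vttt | vt => {vF}
    | vff | vtt => {vtt}
    | vfff | vT => {vT}
  | .KB45, a => match a with
    | vF | vf | vt => {vF}
    | vff | vtt => {vtt}
    | vT => {vT}
    | vfff | vttt => ∅
  | .KD, a => match a with
    | vF | vf | vttt | vt => {vF, vf, vfff}
    | vfff | vT => {vT, vt, vttt}
    | vff | vtt => ∅
  | .KDB, a => match a with
    | vF | vf => {vF}
    | vttt | vt => {vF, vf, vfff}
    | vfff => {vttt}
    | vT => {vT, vt, vttt}
    | vff | vtt => ∅
  | .KD4, a => match a with
    | vF | vttt => {vF}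
    | vf | vt => {vF, vf, vfff}
    | vfff | vT => {vT}
    | vff | vtt => ∅
  | .KD5, a => match a with
    | vF | vf | vttt | vt => {vF}
    | vfff | vT => {vT, vttt}
    | vff | vtt => ∅
  | .KD45, a => match a with
    | vF | vf | vttt | vt => {vF}
    | vfff | vT => {vT}
    | vff | vtt => ∅
  | .KT, a => match a with
    | vF => {vF}
    | vf | vt => {vF, vf}
    | vT => {vT, vt}
    | vff | vfff | vttt | vtt => ∅
  | .KTB, a => match a with
    | vF | vf => {vF}
    | vt => {vF, vf}
    | vT => {vT, vt}
    | vff | vfff | vttt | vtt => ∅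
  | .KT4, a => match a with
    | vF => {vF}
    | vf | vt => {vF, vf}
    | vT => {vT}
    | vff | vfff | vttt | vtt => ∅
  | .KTB45, a => match a with
    | vF | vf | vt => {vF}
    | vT => {vT}
    | vff | vfff | vttt | vtt => ∅

/-- A non-deterministic matrix for the connectives `⊥`, `→`, `□`, with truth values among the
eight values. -/
structure Nmatrix where
  values : Finset Value
  designated : Finset Value
  bot : Finset Value
  imp : Value → Value → Finset Value
  box : Value → Finset Value

/-- The Nmatrix of a logic: the tables, restricted to the truth values of the logic. -/
def Logic.matrix (L : Logic) : Nmatrix where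
  values := L.values
  designated := L.values ∩ desig
  bot := L.values ∩ botTable
  imp a b := L.values ∩ impTable a b
  box a := L.values ∩ boxTable L a

/-! ### Partial valuations and models -/

/-- `v : Λ → Value` is a partial valuation in the Nmatrix `M` (for `Λ` closed under
subformulas). -/
structure IsPartialValuation {At : Type*} (M : Nmatrix) {Λ : Set (Fm At)} (v : Λ → Value) :
    Prop where
  mem_values : ∀ a : Λ, v a ∈ M.values
  bot : ∀ c : Λ, (c : Fm At) = .bot → v c ∈ M.bot
  imp : ∀ a b c : Λ, (c : Fm At) = .imp a b → v c ∈ M.imp (v a) (v b)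
  box : ∀ a c : Λ, (c : Fm At) = .box a → v c ∈ M.box (v a)

/-- `(S, R)` is an `L`-model on `Λ`: a set of partial valuations with a relation on it that
provides the supports and satisfies the relational conditions of necessitation and of all
modal schemata that hold in `L`. -/
structure IsModel {At : Type*} (L : Logic) {Λ : Set (Fm At)} (S : Set (Λ → Value))
    (R : (Λ → Value) → (Λ → Value) → Prop) : Prop where
  isPartialValuation : ∀ v ∈ S, IsPartialValuation L.matrix v
  rel_mem : ∀ v w, R v w → v ∈ S ∧ w ∈ S
  support_P : ∀ v ∈ S, ∀ a, v a ∈ valP → ∃ w ∈ S, R v w ∧ w a ∈ L.matrix.designated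
  support_PN : ∀ v ∈ S, ∀ a, v a ∈ valPN → ∃ w ∈ S, R v w ∧ w a ∉ L.matrix.designated
  nec_N : ∀ v w a, R v w → v a ∈ valN → w a ∈ L.matrix.designated
  nec_I : ∀ v w a, R v w → v a ∈ valI → w a ∉ L.matrix.designated
  cond_T : L.Holds At .T → ∀ v ∈ S, ∀ a,
    (v a ∈ valN → v a ∈ L.matrix.designated) ∧ (v a ∈ valI → v a ∉ L.matrix.designated)
  cond_D : L.Holds At .D → ∀ v ∈ S, ∀ a,
    (v a ∈ valN → v a ∈ valP) ∧ (v a ∈ valI → v a ∈ valPN)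
  cond_B : L.Holds At .B → ∀ v w a, R v w →
    (v a ∈ L.matrix.designated → w a ∈ valP) ∧ (v a ∉ L.matrix.designated → w a ∈ valPN)
  cond_four : L.Holds At .four → ∀ v w a, R v w →
    (v a ∈ valN → w a ∈ valN) ∧ (v a ∈ valI → w a ∈ valI)
  cond_five : L.Holds At .five → ∀ v w a, R v w →
    (v a ∈ valP → w a ∈ valP) ∧ (v a ∈ valPN → w a ∈ valPN)
  cond_five' : L.Holds At .five → ∀ v w u a, R v w → (R v u ∨ R w u) →
    (v a ∈ valN → w a ∈ valN → u a ∈ valN) ∧ (v a ∈ valI → w a ∈ valI → u a ∈ valI)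

/-- A partial level-valuation is a partial valuation that belongs to some `L`-model. -/
def IsPartialLevelValuation {At : Type*} (L : Logic) {Λ : Set (Fm At)} (v : Λ → Value) : Prop :=
  ∃ (S : Set (Λ → Value)) (R : (Λ → Value) → (Λ → Value) → Prop), IsModel L S R ∧ v ∈ S

/-- `Entails L Γ α` is `Γ ⊨ α` in the partial-valuation semantics of `L`: all partial
level-valuations on the subformula closure of `Γ ∪ {α}` that designate `Γ` designate `α`. -/
def Entails {At : Type*} (L : Logic) (Γ : Set (Fm At)) (α : Fm At) : Prop :=
  ∀ v : subformulaClosure (Γ ∪ {α}) → Value, IsPartialLevelValuation L v →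
    (∀ β, ∀ hβ : β ∈ Γ,
      v ⟨β, subset_subformulaClosure _ (Or.inl hβ)⟩ ∈ L.matrix.designated) →
    v ⟨α, subset_subformulaClosure _ (Or.inr rfl)⟩ ∈ L.matrix.designated

end ModalCube

namespace ModalCube

open Value

/-! ### Kripke semantics -/

/-! An `L`-model is almost a Kripke model whose worlds are its valuations, with truth read as
designation. The tables make `□α` designated exactly when the value of `α` is in N; membership in N
forces designation at all successors, and a value outside N lies in PN, which supplies a successor
refuting `α`.

What may fail is that `R` has the frame properties of `L`. But the truth lemma `forces_iff`
tolerates any larger relation along which values in N become designated, so it suffices to enlarge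
`R` to such a relation with the right frame properties (`exists_frame`). Kripke soundness
(`Derives.forces`) then finishes. Write N(v) for the set of formulas with value in N at v. Without
5, inclusions between sets N(v) and sets of designated formulas define the enlargement; with 5, all
successors of a world share one set N, and that set governs accessibility. -/

/-- Truth of a formula at a world of a Kripke model. -/
def Forces {At W : Type*} (R : W → W → Prop) (V : W → At → Prop) : W → Fm At → Prop
  | w, .var p => V w p
  | _, .bot => False
  | w, .imp a b => Forces R V w a → Forces R V w b
  | w, .box a => ∀ u, R w u → Forces R V u a

/-- The property of the accessibility relation that corresponds to a modal schema. -/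
def Schema.FrameCondition {W : Type*} (R : W → W → Prop) : Schema → Prop
  | .D => ∀ v, ∃ w, R v w
  | .T => ∀ v, R v v
  | .B => ∀ v w, R v w → R w v
  | .four => ∀ v w u, R v w → R w u → R v u
  | .five => ∀ v w u, R v w → R v u → R w u

theorem Schema.forces_inst {At W : Type*} {R : W → W → Prop} (V : W → At → Prop) {s : Schema}
    (hs : s.FrameCondition R) (a : Fm At) (w : W) : Forces R V w (s.inst a) := by
  cases s <;> simp only [Schema.inst, Fm.dia, Fm.neg, Forces]
  case D =>
    intro h k
    obtain ⟨u, hu⟩ := hs w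
    exact k u hu (h u hu)
  case T => exact fun h => h w (hs w)
  case B => exact fun h u hu k => k w (hs w u hu) h
  case four => exact fun h u hu x hx => h x (hs w u x hu hx)
  case five => exact fun h u hu k => h fun x hx => k x (hs w u x hu hx)

/-- Soundness of the Hilbert system for Kripke models on suitable frames. -/
theorem Derives.forces {At W : Type*} {L : Logic} {R : W → W → Prop} (V : W → At → Prop)
    (hR : ∀ s ∈ L.schemata, s.FrameCondition R) {Γ : Set (Fm At)} {a : Fm At}
    (h : Derives L Γ a) : ∀ w, (∀ b ∈ Γ, Forces R V w b) → Forces R V w a := by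
  induction h with
  | hyp ha => exact fun w hw => hw _ ha
  | ax1 a b => exact fun w _ ha _ => ha
  | ax2 a b c => exact fun w _ h k ha => h ha (k ha)
  | ax3 a => exact fun w _ h => by_contra h
  | axK a b => exact fun w _ h k u hu => h u hu (k u hu)
  | modal s a hs => exact fun w _ => s.forces_inst V (hR s hs) a w
  | mp _ _ ih₁ ih₂ => exact fun w hw => ih₁ w hw (ih₂ w hw)
  | nec _ ih => exact fun w _ u _ => ih u fun b hb => absurd hb (Set.notMem_empty b)

/-! ### Truth tables -/

theorem notMem_valN {x : Value} : x ∉ valN ↔ x ∈ valPN := by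
  cases x <;> decide

theorem notMem_valI {x : Value} : x ∉ valI ↔ x ∈ valP := by
  cases x <;> decide

theorem desig_of_mem_impTable {x y z : Value} (h : z ∈ impTable x y) :
    z ∈ desig ↔ (x ∈ desig → y ∈ desig) := by
  revert h
  cases x <;> cases y <;> cases z <;> decide

theorem desig_of_mem_boxTable {L : Logic} {x z : Value} (h : z ∈ boxTable L x) :
    z ∈ desig ↔ x ∈ valN := by
  revert h
  cases L <;> cases x <;> cases z <;> decide

theorem notMem_desig_of_mem_botTable {z : Value} (h : z ∈ botTable) : z ∉ desig := by
  revert h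
  cases z <;> decide

theorem IsPartialValuation.mem_designated {At : Type*} {L : Logic} {Λ : Set (Fm At)}
    {v : Λ → Value} (hv : IsPartialValuation L.matrix v) (a : Λ) :
    v a ∈ L.matrix.designated ↔ v a ∈ desig :=
  ⟨fun h => (Finset.mem_inter.1 h).2, fun h => Finset.mem_inter.2 ⟨hv.mem_values a, h⟩⟩

/-- Only the model conditions of the axioms of `L` are needed, so it is never necessary to decide
which other schemata are theorems. -/
theorem Logic.holds_of_mem {At : Type*} {L : Logic} {s : Schema} (h : s ∈ L.schemata) :
    L.Holds At s :=
  fun a => .modal s a h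

/-! ### Truth lemma and seriality -/

namespace IsModel

variable {At : Type*} {L : Logic} {Λ : Set (Fm At)} {S : Set (Λ → Value)}
  {R : (Λ → Value) → (Λ → Value) → Prop}

/-- The truth lemma: a relation that extends that of a model and respects necessity yields a
Kripke model in which truth is designation. -/
theorem forces_iff (hM : IsModel L S R) (hΛ : SubformulaClosed Λ) {Q : S → S → Prop}
    (hRQ : ∀ v w : S, R v w → Q v w)
    (hQ : ∀ v w : S, Q v w → ∀ a, v.1 a ∈ valN → w.1 a ∈ L.matrix.designated)
    (a : Fm At) (ha : a ∈ Λ) (v : S) :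
    Forces Q (fun w p => ∃ h : Fm.var p ∈ Λ, w.1 ⟨.var p, h⟩ ∈ desig) v a ↔
      v.1 ⟨a, ha⟩ ∈ desig := by
  induction a generalizing v with
  | var p => exact ⟨fun ⟨_, h⟩ => h, fun h => ⟨ha, h⟩⟩
  | bot =>
    have hv := (hM.isPartialValuation v v.2).bot ⟨.bot, ha⟩ rfl
    exact ⟨False.elim, notMem_desig_of_mem_botTable (Finset.mem_inter.1 hv).2⟩
  | imp a b iha ihb =>
    obtain ⟨ha', hb'⟩ := hΛ.1 a b ha
    have hv := (hM.isPartialValuation v v.2).imp ⟨a, ha'⟩ ⟨b, hb'⟩ ⟨.imp a b, ha⟩ rfl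
    rw [desig_of_mem_impTable (Finset.mem_inter.1 hv).2, ← iha ha' v, ← ihb hb' v]
    rfl
  | box a ih =>
    have ha' := hΛ.2 a ha
    have hv := (hM.isPartialValuation v v.2).box ⟨a, ha'⟩ ⟨.box a, ha⟩ rfl
    rw [desig_of_mem_boxTable (Finset.mem_inter.1 hv).2]
    constructor
    · intro h
      -- The refuting successor is an `R`-successor, hence also a `Q`-successor.
      by_contra hN
      obtain ⟨w, hw, hvw, hwa⟩ := hM.support_PN v v.2 _ (notMem_valN.1 hN)
      exact hwa (((hM.isPartialValuation w hw).mem_designated _).2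
        ((ih ha' ⟨w, hw⟩).1 (h ⟨w, hw⟩ (hRQ v ⟨w, hw⟩ hvw))))
    · exact fun hN w hvw => (ih ha' w).2
        (((hM.isPartialValuation w w.2).mem_designated _).1 (hQ v w hvw _ hN))

/-- A value outside N ∩ I lies in P or PN, and either one demands a support. The formula `a`
matters: on an empty Λ nothing would demand a successor. -/
theorem exists_rel (hM : IsModel L S R) {v : Λ → Value} (hv : v ∈ S) {a : Λ}
    (h : v a ∈ valN → v a ∉ valI) : ∃ w ∈ S, R v w := by
  by_cases hN : v a ∈ valN
  · obtain ⟨w, hw, hvw, -⟩ := hM.support_P v hv a (notMem_valI.1 (h hN))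
    exact ⟨w, hw, hvw⟩
  · obtain ⟨w, hw, hvw, -⟩ := hM.support_PN v hv a (notMem_valN.1 hN)
    exact ⟨w, hw, hvw⟩

theorem serial (hM : IsModel L S R) (a : Λ) (hD : Schema.D ∈ L.schemata) {v : Λ → Value}
    (hv : v ∈ S) : ∃ w ∈ S, R v w :=
  hM.exists_rel hv fun h => notMem_valI.2 ((hM.cond_D (Logic.holds_of_mem hD) v hv a).1 h)

theorem serial_of_T (hM : IsModel L S R) (a : Λ) (hT : Schema.T ∈ L.schemata) {v : Λ → Value}
    (hv : v ∈ S) : ∃ w ∈ S, R v w := by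
  have hc := hM.cond_T (Logic.holds_of_mem hT) v hv a
  exact hM.exists_rel hv fun h h' => hc.2 h' (hc.1 h)

theorem designated_of_rel (hM : IsModel L S R) (hB : Schema.B ∈ L.schemata) {v w : Λ → Value}
    (hvw : R v w) (a : Λ) (h : w a ∈ valN) : v a ∈ L.matrix.designated := by
  by_contra hv
  exact notMem_valN.2 ((hM.cond_B (Logic.holds_of_mem hB) v w a hvw).2 hv) h

/-! ### Consequences of the conditions for 5 -/

section Five

variable (hM : IsModel L S R) (h5 : Schema.five ∈ L.schemata)
include hM h5

theorem valN_of_rel {v w : Λ → Value} (hvw : R v w) (a : Λ) (h : w a ∈ valN) :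
    v a ∈ valN := by
  by_contra hv
  exact notMem_valN.2
    ((hM.cond_five (Logic.holds_of_mem h5) v w a hvw).2 (notMem_valN.1 hv)) h

theorem valI_of_rel {v w : Λ → Value} (hvw : R v w) (a : Λ) (h : w a ∈ valI) :
    v a ∈ valI := by
  by_contra hv
  exact notMem_valI.2
    ((hM.cond_five (Logic.holds_of_mem h5) v w a hvw).1 (notMem_valI.1 hv)) h

/-- If `w a` were in both N and I, then so would be `v a` by 5, and `w a` would have to be both
designated and undesignated. -/
theorem exists_rel_of_rel (a : Λ) {v w : Λ → Value} (hvw : R v w) : ∃ u ∈ S, R w u :=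
  hM.exists_rel (hM.rel_mem v w hvw).2 (a := a) fun h h' =>
    hM.nec_I v w a hvw (hM.valI_of_rel h5 hvw a h')
      (hM.nec_N v w a hvw (hM.valN_of_rel h5 hvw a h))

theorem valN_iff_of_rel_rel {v w u : Λ → Value} (hvw : R v w) (hwu : R w u) (a : Λ) :
    u a ∈ valN ↔ w a ∈ valN :=
  ⟨hM.valN_of_rel h5 hwu a, fun h =>
    (hM.cond_five' (Logic.holds_of_mem h5) v w u a hvw (.inr hwu)).1
      (hM.valN_of_rel h5 hvw a h) h⟩

end Five

end IsModel

/-- The accessibility relation for logics without the schema 5: the largest one that respects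
the conditions of the logic. -/
def looseRel {At : Type*} (L : Logic) {Λ : Set (Fm At)} (S : Set (Λ → Value)) (v w : S) : Prop :=
  (∀ a, v.1 a ∈ valN → w.1 a ∈ L.matrix.designated) ∧
  (Schema.B ∈ L.schemata → ∀ a, w.1 a ∈ valN → v.1 a ∈ L.matrix.designated) ∧
  (Schema.four ∈ L.schemata → ∀ a, v.1 a ∈ valN → w.1 a ∈ valN)

/-- The valuations that may be seen by others when the schema 5 holds. -/
def IsCore {At : Type*} (L : Logic) {Λ : Set (Fm At)} (R : (Λ → Value) → (Λ → Value) → Prop)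
    (w : Λ → Value) : Prop :=
  (∀ a, w a ∈ valN → w a ∈ L.matrix.designated) ∧
  ∃ u, R w u ∧ ∀ a, u a ∈ valN ↔ w a ∈ valN

/-- The accessibility relation for logics with the schema 5. -/
def euclideanRel {At : Type*} (L : Logic) {Λ : Set (Fm At)} (S : Set (Λ → Value))
    (R : (Λ → Value) → (Λ → Value) → Prop) (v w : S) : Prop :=
  IsCore L R w.1 ∧ (∀ a, v.1 a ∈ valN → w.1 a ∈ L.matrix.designated) ∧
  ∃ u, R v.1 u ∧ ∀ a, u a ∈ valN ↔ w.1 a ∈ valN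

/-! ### Frame properties of the enlarged relations -/

namespace IsModel

variable {At : Type*} {L : Logic} {Λ : Set (Fm At)} {S : Set (Λ → Value)}
  {R : (Λ → Value) → (Λ → Value) → Prop}

theorem looseRel_of_rel (hM : IsModel L S R) (v w : S) (h : R v w) : looseRel L S v w :=
  ⟨fun a => hM.nec_N v w a h, fun hB => hM.designated_of_rel hB h,
    fun h4 a => (hM.cond_four (Logic.holds_of_mem h4) v w a h).1⟩

theorem euclideanRel_of_rel (hM : IsModel L S R) (h5 : Schema.five ∈ L.schemata) (a : Λ)
    (v w : S) (h : R v w) : euclideanRel L S R v w := by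
  obtain ⟨u, -, hu⟩ := hM.exists_rel_of_rel h5 a h
  exact ⟨⟨fun b hb => hM.nec_N v w b h (hM.valN_of_rel h5 h b hb), u, hu,
    hM.valN_iff_of_rel_rel h5 h hu⟩, fun b => hM.nec_N v w b h, w, h, fun _ => Iff.rfl⟩

theorem frameCondition_looseRel (hM : IsModel L S R) (a : Λ) (h5 : Schema.five ∉ L.schemata)
    (s : Schema) (hs : s ∈ L.schemata) : s.FrameCondition (looseRel L S) := by
  -- This exclusion is essential: the clause for 4 is not symmetric, and the clause for B does not
  -- compose.
  have h4B : Schema.B ∈ L.schemata → Schema.four ∉ L.schemata := by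
    cases L <;> simp [Logic.schemata] at h5 ⊢
  cases s with
  | D =>
    intro v
    obtain ⟨w, hw, hvw⟩ := hM.serial a hs v.2
    exact ⟨⟨w, hw⟩, hM.looseRel_of_rel v ⟨w, hw⟩ hvw⟩
  | T =>
    intro v
    have hv := fun b => (hM.cond_T (Logic.holds_of_mem hs) v v.2 b).1
    exact ⟨hv, fun _ => hv, fun _ _ => id⟩
  | B => exact fun v w h => ⟨h.2.1 hs, fun _ => h.1, fun h4 => absurd h4 (h4B hs)⟩
  | four =>
    exact fun v w u h k => ⟨fun b hb => k.1 b (h.2.2 hs b hb),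
      fun hB => absurd hs (h4B hB), fun _ b hb => k.2.2 hs b (h.2.2 hs b hb)⟩
  | five => exact absurd hs h5

/-- Accessibility of a core world from v depends on the set N shared by the `R`-successors of v.
Core worlds have the same set N as their own successors, so this set is passed along. -/
theorem frameCondition_euclideanRel (hM : IsModel L S R) (a : Λ)
    (h5 : Schema.five ∈ L.schemata) (s : Schema) (hs : s ∈ L.schemata) :
    s.FrameCondition (euclideanRel L S R) := by
  have h4 : Schema.B ∈ L.schemata ∨ Schema.T ∈ L.schemata → Schema.four ∈ L.schemata := by
    cases L <;> simp [Logic.schemata] at h5 ⊢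
  -- Under 4 and 5 together, N(v) is constant along `R`.
  have hN : Schema.four ∈ L.schemata → ∀ v w, R v w → ∀ b, w b ∈ valN ↔ v b ∈ valN :=
    fun h4 v w hvw b => ⟨hM.valN_of_rel h5 hvw b,
      (hM.cond_four (Logic.holds_of_mem h4) v w b hvw).1⟩
  cases s with
  | D =>
    intro v
    obtain ⟨w, hw, hvw⟩ := hM.serial a hs v.2
    exact ⟨⟨w, hw⟩, hM.euclideanRel_of_rel h5 a v ⟨w, hw⟩ hvw⟩
  | T =>
    intro v
    have hv := fun b => (hM.cond_T (Logic.holds_of_mem hs) v v.2 b).1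
    obtain ⟨w, -, hvw⟩ := hM.serial_of_T a hs v.2
    have hw : ∃ u, R v.1 u ∧ ∀ b, u b ∈ valN ↔ v.1 b ∈ valN :=
      ⟨w, hvw, hN (h4 (.inr hs)) v w hvw⟩
    exact ⟨⟨hv, hw⟩, hv, hw⟩
  | B =>
    -- Here v must itself be shown to be core: N(v) = N(u) by 4 and 5, and B makes the formulas in
    -- N(u) designated at v.
    rintro v w ⟨⟨-, x, hwx, hx⟩, -, u, hvu, hu⟩
    have huv := hN (h4 (.inl hs)) v u hvu
    have hv : ∀ b, u b ∈ valN → v.1 b ∈ L.matrix.designated := hM.designated_of_rel hs hvu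
    exact ⟨⟨fun b hb => hv b ((huv b).2 hb), u, hvu, huv⟩, fun b hb => hv b ((hu b).2 hb),
      x, hwx, fun b => (hx b).trans ((hu b).symm.trans (huv b))⟩
  | four =>
    rintro v w x ⟨-, -, u, hvu, hu⟩ ⟨hx, -, y, hwy, hy⟩
    have hux : ∀ b, u b ∈ valN ↔ x.1 b ∈ valN := fun b =>
      (hu b).trans ((hN hs w y hwy b).symm.trans (hy b))
    exact ⟨hx, fun b hb => hx.1 b ((hux b).1 ((hN hs v u hvu b).2 hb)), u, hvu, hux⟩
  | five =>
    rintro v w x ⟨⟨-, z, hwz, hz⟩, -, u, hvu, hu⟩ ⟨hx, -, y, hvy, hy⟩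
    -- Two successors of v have the same set N: 5 pulls membership back to v, and its second
    -- condition carries it from v and one successor to the other.
    have huy : ∀ b, u b ∈ valN ↔ y b ∈ valN := fun b => by
      refine ⟨fun h => ?_, fun h => ?_⟩
      · exact (hM.cond_five' (Logic.holds_of_mem h5) v u y b hvu (.inl hvy)).1
          (hM.valN_of_rel h5 hvu b h) h
      · exact (hM.cond_five' (Logic.holds_of_mem h5) v y u b hvy (.inl hvu)).1
          (hM.valN_of_rel h5 hvy b h) h
    have hwx : ∀ b, w.1 b ∈ valN ↔ x.1 b ∈ valN := fun b =>
      (hu b).symm.trans ((huy b).trans (hy b))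
    exact ⟨hx, fun b hb => hx.1 b ((hwx b).1 hb), z, hwz, fun b => (hz b).trans (hwx b)⟩

/-- The relation of a model extends to one that respects necessity and has the frame
properties of the logic. -/
theorem exists_frame (hM : IsModel L S R) (a : Λ) : ∃ Q : S → S → Prop,
    (∀ v w : S, R v w → Q v w) ∧
    (∀ v w : S, Q v w → ∀ a, v.1 a ∈ valN → w.1 a ∈ L.matrix.designated) ∧
    ∀ s ∈ L.schemata, s.FrameCondition Q := by
  by_cases h5 : Schema.five ∈ L.schemata
  · exact ⟨euclideanRel L S R, hM.euclideanRel_of_rel h5 a, fun _ _ h => h.2.1,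
      hM.frameCondition_euclideanRel a h5⟩
  · exact ⟨looseRel L S, hM.looseRel_of_rel, fun _ _ h => h.1,
      hM.frameCondition_looseRel a h5⟩

end IsModel

end ModalCube

theorem mainTheorem6 {At : Type*} (L : ModalCube.Logic) (Γ : Set (ModalCube.Fm At))
    (α : ModalCube.Fm At) (h : ModalCube.Derives L Γ α) : ModalCube.Entails L Γ α := by
  rintro v ⟨S, R, hM, hv⟩ hΓ
  have hα := ModalCube.subset_subformulaClosure (Γ ∪ {α}) (Or.inr rfl)
  obtain ⟨Q, hRQ, hQ, hF⟩ := hM.exists_frame ⟨α, hα⟩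
  have hT := hM.forces_iff (ModalCube.subformulaClosed_subformulaClosure _) hRQ hQ
  have hd := (hM.isPartialValuation v hv).mem_designated
  exact (hd _).2 ((hT α hα ⟨v, hv⟩).1 (h.forces _ hF ⟨v, hv⟩ fun β hβ =>
    (hT β _ ⟨v, hv⟩).2 ((hd _).1 (hΓ β hβ))))
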